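/- For $\lambda>-1$ and $\mu\in\mathbb{C}$ let $W_{\lambda,\mu}(z)=\sum_{n=0}^\infty \frac{z^n}{n!\,\Gamma(\lambda n+\mu)}$ be the Wright function (with $1/\Gamma=0$ at the poles of $\Gamma$), and for $0<\gamma<1$ let $M_\gamma(z)=W_{-\gamma,1-\gamma}(-z)$. Let $\mathrm{Ai}$ be the (entire) Airy function of the first kind, $\mathrm{Ai}'$ its derivative, and $K_\nu$ the modified Bessel function of the second kind on its principal branch, $\arg\in(-\pi,\pi]$. Then: (i) for every $z\in\mathbb{C}$, $$M_{2/3}(z)=\left[3^{-1/3}\,z\,\mathrm{Ai}\!\left(\frac{z^2}{3^{4/3}}\right)-3^{1/3}\,\mathrm{Ai}'\!\left(\frac{z^2}{3^{4/3}}\right)\right]e^{-2z^3/27};$$ (ii) for every $z\in\mathbb{C}\setminus\{0\}$ with $-\pi/3<\arg z\le\pi/3$ (in particular for every real $z>0$), $$M_{2/3}(z)=\frac{z^2}{3^{3/2}\,\pi}\left[K_{1/3}\!\left(\frac{2z^3}{27}\right)+K_{2/3}\!\left(\frac{2z^3}{27}\right)\right]e^{-2z^3/27}.$$ -/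

import Mathlib

noncomputable section

/-- The Wright function `W_{lam,mu}(z) = ∑ zⁿ / (n! Γ(n lam + mu))` (for `lam > -1`).
At the poles of `Γ` the term vanishes, since `Complex.Gamma` is `0` there and so is its inverse. -/
def wrightW (lam : ℝ) (mu z : ℂ) : ℂ :=
  ∑' n : ℕ, z ^ n / ((n.factorial : ℂ) * Complex.Gamma ((n : ℂ) * (lam : ℂ) + mu))

/-- The function `M_γ(z) = W_{-γ,1-γ}(-z)` (for `0 < γ < 1`). -/
def wrightM (γ : ℝ) (z : ℂ) : ℂ :=
  wrightW (-γ) (1 - (γ : ℂ)) (-z)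

/-- The solution `f` of `w'' = z w` with `f(0) = 1`, `f'(0) = 0`:
`f(z) = ∑ 3ᵏ (1/3)ₖ z^{3k} / (3k)!`, where `(a)ₖ = a (a+1) ⋯ (a+k-1)`. -/
def airyF (z : ℂ) : ℂ :=
  ∑' k : ℕ, 3 ^ k * (ascPochhammer ℂ k).eval (1 / 3 : ℂ) * z ^ (3 * k)
    / ((3 * k).factorial : ℂ)

/-- The solution `g` of `w'' = z w` with `g(0) = 0`, `g'(0) = 1`:
`g(z) = ∑ 3ᵏ (2/3)ₖ z^{3k+1} / (3k+1)!`. -/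
def airyG (z : ℂ) : ℂ :=
  ∑' k : ℕ, 3 ^ k * (ascPochhammer ℂ k).eval (2 / 3 : ℂ) * z ^ (3 * k + 1)
    / ((3 * k + 1).factorial : ℂ)

/-- The Airy function of the first kind `Ai(z) = c₁ f(z) - c₂ g(z)`, with
`c₁ = Ai(0) = 3^{-2/3} / Γ(2/3)` and `c₂ = -Ai'(0) = 3^{-1/3} / Γ(1/3)`. -/
def airyAi (z : ℂ) : ℂ :=
  (((3 : ℝ) ^ (-(2 / 3) : ℝ) / Real.Gamma (2 / 3) : ℝ) : ℂ) * airyF z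
    - (((3 : ℝ) ^ (-(1 / 3) : ℝ) / Real.Gamma (1 / 3) : ℝ) : ℂ) * airyG z

/-- The modified Bessel function of the first kind (principal branch)
`I_ν(z) = (z/2)^ν ∑ (z²/4)ᵏ / (k! Γ(ν + k + 1))`. -/
def besselI (ν z : ℂ) : ℂ :=
  (z / 2) ^ ν *
    ∑' k : ℕ, (z ^ 2 / 4) ^ k / ((k.factorial : ℂ) * Complex.Gamma (ν + (k : ℂ) + 1))

open scoped Classical in
/-- The modified Bessel function of the second kind (principal branch)
`K_ν(z) = (π/2) (I_{-ν}(z) - I_ν(z)) / sin(ν π)`, the right-hand side being replaced by its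
limit in the order when `ν` is an integer. -/
def besselK (ν z : ℂ) : ℂ :=
  if ∃ m : ℤ, ν = (m : ℂ) then
    Filter.limUnder (nhdsWithin ν {ν}ᶜ) fun μ : ℂ =>
      (Real.pi : ℂ) / 2 * (besselI (-μ) z - besselI μ z) / Complex.sin (μ * (Real.pi : ℂ))
  else
    (Real.pi : ℂ) / 2 * (besselI (-ν) z - besselI ν z) / Complex.sin (ν * (Real.pi : ℂ))

end

/-!
Differentiating the Wright series raises `μ` by `λ`, and the functional equation of `Γ` gives the
contiguous relation `W_{λ,μ-1}(z) = λ z W_{λ,λ+μ}(z) + (μ-1) W_{λ,μ}(z)`. For `λ = -2/3` and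
`μ = 1/3` the parameters reached in this way close up: `M = M_{2/3}` solves
`M'' = -(4/9) z² M' - (10/9) z M`. By Airy's equation `(t Ai(t²) - Ai'(t²)) exp(-2t³/3)` solves the
same equation after the rescaling `z = 3^{2/3} t`, and comparing initial values gives (i).

The series of `Ai`, `Ai'` and `I_ν` are all of the form `W_{1,μ}`, so on the sector where the
principal cube root inverts the cube, `Ai(t²)` and `Ai'(t²)` are multiples of `K_{1/3}(2t³/3)` and
`K_{2/3}(2t³/3)`, which turns (i) into (ii).
-/

open Filter Topology

section ReciprocalGamma

theorem norm_complexGamma_le_Gamma_re {s : ℂ} (hs : 0 < s.re) :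
    ‖Complex.Gamma s‖ ≤ Real.Gamma s.re := by
  rw [Complex.Gamma_eq_integral hs, Real.Gamma_eq_integral hs]
  refine (MeasureTheory.norm_integral_le_integral_norm _).trans_eq
    (MeasureTheory.setIntegral_congr_fun measurableSet_Ioi fun x hx => ?_)
  simp [Complex.norm_cpow_eq_rpow_re_of_pos hx, Complex.norm_exp]

theorem norm_sin_le_exp_abs_im (w : ℂ) : ‖Complex.sin w‖ ≤ Real.exp |w.im| := by
  have h₁ : Real.exp w.im ≤ Real.exp |w.im| := Real.exp_le_exp.2 (le_abs_self _)
  have h₂ : Real.exp (-w.im) ≤ Real.exp |w.im| := Real.exp_le_exp.2 (neg_le_abs _)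
  have hsub := norm_sub_le (Complex.exp (-w * Complex.I)) (Complex.exp (w * Complex.I))
  simp only [Complex.norm_exp, Complex.mul_I_re, Complex.neg_im, neg_neg] at hsub
  rw [Complex.sin, norm_div, norm_mul, Complex.norm_I, mul_one, Complex.norm_ofNat]
  linarith

theorem norm_inv_Gamma_le_of_re_lt_one {w : ℂ} (hw : w.re < 1) :
    ‖(Complex.Gamma w)⁻¹‖ ≤ Real.Gamma (1 - w.re) * (Real.exp (Real.pi * |w.im|) / Real.pi) := by
  have hre : 0 < (1 - w).re := by simpa using hw
  have hreflection : (Complex.Gamma w)⁻¹ =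
      Complex.Gamma (1 - w) * (Complex.sin (Real.pi * w) / Real.pi) := by
    have hΓ := Complex.Gamma_ne_zero_of_re_pos hre
    rw [← inv_div, ← Complex.Gamma_mul_Gamma_one_sub, mul_inv, mul_left_comm, mul_inv_cancel₀ hΓ,
      mul_one]
  have hsin := norm_sin_le_exp_abs_im (Real.pi * w)
  rw [Complex.im_ofReal_mul, abs_mul, abs_of_pos Real.pi_pos] at hsin
  rw [hreflection, norm_mul, norm_div, Complex.norm_of_nonneg Real.pi_pos.le]
  gcongr
  simpa using norm_complexGamma_le_Gamma_re hre

theorem norm_inv_Gamma_add_one_le {w : ℂ} (hw : 1 ≤ w.re) :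
    ‖(Complex.Gamma (w + 1))⁻¹‖ ≤ ‖(Complex.Gamma w)⁻¹‖ := by
  have hnorm : 1 ≤ ‖w‖ := hw.trans (Complex.re_le_norm w)
  rw [Complex.one_div_Gamma_eq_self_mul_one_div_Gamma_add_one w, norm_mul]
  exact le_mul_of_one_le_left (norm_nonneg _) hnorm

theorem exists_norm_inv_Gamma_le_of_le_re_of_abs_im_le (a Y : ℝ) :
    ∃ C, ∀ w : ℂ, a ≤ w.re → |w.im| ≤ Y → ‖(Complex.Gamma w)⁻¹‖ ≤ C := by
  set b := max a 1 + 1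
  have hab : a ≤ b - 1 := by simp [b]
  have hb : 1 ≤ b - 1 := by simp [b]
  obtain ⟨C, hC⟩ := (isCompact_Icc.reProdIm isCompact_Icc).exists_bound_of_continuousOn
    (s := Set.Icc a b ×ℂ Set.Icc (-Y) Y)
    Complex.differentiable_one_div_Gamma.continuous.continuousOn
  have hstrip : ∀ (n : ℕ) (w : ℂ), a ≤ w.re → w.re ≤ b + n → |w.im| ≤ Y →
      ‖(Complex.Gamma w)⁻¹‖ ≤ C := by
    intro n
    induction n with
    | zero => exact fun w ha hw hY => hC w ⟨⟨ha, by simpa using hw⟩, abs_le.1 hY⟩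
    | succ n ih =>
      intro w ha hw hY
      push_cast at hw
      rcases le_total w.re b with hwb | hbw
      · exact hC w ⟨⟨ha, hwb⟩, abs_le.1 hY⟩
      · have hre : (w - 1).re = w.re - 1 := by simp
        have hshift := norm_inv_Gamma_add_one_le (w := w - 1) (by linarith)
        rw [sub_add_cancel] at hshift
        exact hshift.trans (ih (w - 1) (by linarith) (by linarith) (by simpa using hY))
  refine ⟨C, fun w ha hY => ?_⟩
  obtain ⟨n, hn⟩ := exists_nat_ge (w.re - b)
  exact hstrip n w ha (by linarith) hY

theorem Gamma_add_le_Gamma_mul_rpow {x γ : ℝ} (hx : 0 < x) (hγ₀ : 0 < γ) (hγ₁ : γ < 1) :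
    Real.Gamma (x + γ) ≤ Real.Gamma x * x ^ γ := by
  have hΓ := Real.Gamma_pos_of_pos hx
  calc Real.Gamma (x + γ) = Real.Gamma ((1 - γ) * x + γ * (x + 1)) := by ring_nf
    _ ≤ Real.Gamma x ^ (1 - γ) * Real.Gamma (x + 1) ^ γ :=
      Real.Gamma_mul_add_mul_le_rpow_Gamma_mul_rpow_Gamma hx (by linarith) (by linarith) hγ₀
        (by ring)
    _ = Real.Gamma x * x ^ γ := by
      rw [Real.Gamma_add_one hx.ne', Real.mul_rpow hx.le hΓ.le, mul_left_comm,
        ← Real.rpow_add hΓ, sub_add_cancel, Real.rpow_one, mul_comm]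

theorem summable_Gamma_mul_pow_div_factorial {γ : ℝ} (hγ₀ : 0 < γ) (hγ₁ : γ < 1) (b r : ℝ) :
    Summable fun n : ℕ => Real.Gamma (γ * n + b) * r ^ n / n.factorial := by
  have hnat : Tendsto (fun n : ℕ => (n : ℝ)) atTop atTop := tendsto_natCast_atTop_atTop
  have hpos : ∀ᶠ n : ℕ in atTop, 0 < γ * n + b :=
    (tendsto_atTop_add_const_right _ b (hnat.const_mul_atTop hγ₀)).eventually_gt_atTop 0
  have hle : ∀ᶠ n : ℕ in atTop, γ * n + b ≤ n + 1 := by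
    filter_upwards [(hnat.const_mul_atTop (sub_pos.2 hγ₁)).eventually_ge_atTop (b - 1)] with n hn
    linarith
  have hratio : ∀ᶠ n : ℕ in atTop, |r| * ((n : ℝ) + 1) ^ (-(1 - γ)) ≤ 1 / 2 := by
    have hlim := ((tendsto_rpow_neg_atTop (sub_pos.2 hγ₁)).comp
      (tendsto_atTop_add_const_right _ (1 : ℝ) hnat)).const_mul |r|
    rw [mul_zero] at hlim
    exact hlim.eventually_le_const (by norm_num)
  refine summable_of_ratio_norm_eventually_le (r := 1 / 2) (by norm_num) ?_
  filter_upwards [hpos, hle, hratio] with n hx hxn hr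
  have hn : (0 : ℝ) < n + 1 := by positivity
  have hΓ := Real.Gamma_pos_of_pos hx
  have hΓsucc : Real.Gamma (γ * (n + 1 : ℕ) + b) ≤ Real.Gamma (γ * n + b) * ((n : ℝ) + 1) ^ γ := by
    rw [show γ * (n + 1 : ℕ) + b = γ * n + b + γ by push_cast; ring]
    refine (Gamma_add_le_Gamma_mul_rpow hx hγ₀ hγ₁).trans ?_
    gcongr
  have hΓsucc₀ : 0 < Real.Gamma (γ * (n + 1 : ℕ) + b) :=
    Real.Gamma_pos_of_pos (by push_cast; linarith)
  simp only [norm_div, norm_mul, norm_pow, Real.norm_eq_abs, abs_of_pos hΓ, abs_of_pos hΓsucc₀,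
    Nat.abs_cast]
  calc _ ≤ Real.Gamma (γ * n + b) * ((n : ℝ) + 1) ^ γ * |r| ^ (n + 1) / (n + 1).factorial := by
        gcongr
    _ = |r| * ((n : ℝ) + 1) ^ (-(1 - γ)) * (Real.Gamma (γ * n + b) * |r| ^ n / n.factorial) := by
        rw [neg_sub, Real.rpow_sub_one hn.ne', Nat.factorial_succ, pow_succ]
        push_cast
        field_simp
    _ ≤ _ := by gcongr

end ReciprocalGamma

section WrightFunction

theorem summable_norm_wrightW_term_of_nonneg {lam : ℝ} (hlam : 0 ≤ lam) (mu z : ℂ) :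
    Summable fun n : ℕ =>
      ‖z ^ n / ((n.factorial : ℂ) * Complex.Gamma ((n : ℂ) * (lam : ℂ) + mu))‖ := by
  obtain ⟨C, hC⟩ := exists_norm_inv_Gamma_le_of_le_re_of_abs_im_le mu.re |mu.im|
  refine .of_nonneg_of_le (fun _ => norm_nonneg _) (fun n => ?_)
    ((Real.summable_pow_div_factorial ‖z‖).mul_right C)
  have hΓ := hC (n * lam + mu)
    (by simpa using mul_nonneg n.cast_nonneg hlam) (by simp)
  rw [← div_div, div_eq_mul_inv, norm_mul, norm_div, norm_pow, Complex.norm_natCast]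
  gcongr

theorem summable_norm_wrightW_term_of_neg {lam : ℝ} (hlam : -1 < lam) (hneg : lam < 0) (mu z : ℂ) :
    Summable fun n : ℕ =>
      ‖z ^ n / ((n.factorial : ℂ) * Complex.Gamma ((n : ℂ) * (lam : ℂ) + mu))‖ := by
  refine .of_norm_bounded_eventually_nat
    ((summable_Gamma_mul_pow_div_factorial (neg_pos.2 hneg) (neg_lt.1 hlam) (1 - mu.re)
      ‖z‖).mul_right (Real.exp (Real.pi * |mu.im|) / Real.pi)) ?_
  filter_upwards [(tendsto_natCast_atTop_atTop.const_mul_atTop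
    (neg_pos.2 hneg)).eventually_gt_atTop (mu.re - 1)] with n hn
  have hΓ := norm_inv_Gamma_le_of_re_lt_one (w := n * lam + mu) (by simp; linarith)
  simp only [Complex.add_re, Complex.add_im, Complex.re_mul_ofReal, Complex.im_mul_ofReal,
    Complex.natCast_re, Complex.natCast_im, zero_mul, zero_add] at hΓ
  rw [norm_norm, ← div_div, div_eq_mul_inv, norm_mul, norm_div, norm_pow, Complex.norm_natCast]
  calc _ ≤ ‖z‖ ^ n / n.factorial * (Real.Gamma (1 - (n * lam + mu.re))
          * (Real.exp (Real.pi * |mu.im|) / Real.pi)) := by gcongr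
    _ = _ := by ring_nf

theorem summable_norm_wrightW_term {lam : ℝ} (hlam : -1 < lam) (mu z : ℂ) :
    Summable fun n : ℕ =>
      ‖z ^ n / ((n.factorial : ℂ) * Complex.Gamma ((n : ℂ) * (lam : ℂ) + mu))‖ :=
  (lt_or_ge lam 0).elim (fun h => summable_norm_wrightW_term_of_neg hlam h mu z)
    fun h => summable_norm_wrightW_term_of_nonneg h mu z

theorem wrightW_zero (lam : ℝ) (mu : ℂ) : wrightW lam mu 0 = (Complex.Gamma mu)⁻¹ := by
  rw [wrightW, tsum_eq_single 0 fun n hn => by simp [hn]]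
  simp

theorem succ_mul_pow_div_factorial_mul_Gamma (lam : ℝ) (mu z : ℂ) (n : ℕ) :
    (n + 1 : ℕ) * z ^ n / (((n + 1).factorial : ℂ) *
      Complex.Gamma (((n + 1 : ℕ) : ℂ) * (lam : ℂ) + mu)) =
    z ^ n / ((n.factorial : ℂ) * Complex.Gamma ((n : ℂ) * (lam : ℂ) + (lam + mu))) := by
  have harg : ((n + 1 : ℕ) : ℂ) * (lam : ℂ) + mu = n * lam + (lam + mu) := by push_cast; ring
  rw [harg, Nat.factorial_succ, Nat.cast_mul, mul_assoc,
    mul_div_mul_left _ _ (Nat.cast_ne_zero.2 n.succ_ne_zero)]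

theorem summable_norm_deriv_wrightW_term {lam : ℝ} (hlam : -1 < lam) (mu z : ℂ) :
    Summable fun n : ℕ =>
      ‖n * z ^ (n - 1) / ((n.factorial : ℂ) * Complex.Gamma ((n : ℂ) * (lam : ℂ) + mu))‖ := by
  refine (summable_nat_add_iff 1).1 ?_
  simp only [Nat.add_sub_cancel, succ_mul_pow_div_factorial_mul_Gamma]
  exact summable_norm_wrightW_term hlam (lam + mu) z

theorem tsum_deriv_wrightW_term {lam : ℝ} (hlam : -1 < lam) (mu z : ℂ) :
    ∑' n : ℕ, n * z ^ (n - 1) / ((n.factorial : ℂ) * Complex.Gamma ((n : ℂ) * (lam : ℂ) + mu)) =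
      wrightW lam (lam + mu) z := by
  rw [(summable_norm_deriv_wrightW_term hlam mu z).of_norm.tsum_eq_zero_add]
  simp only [Nat.add_sub_cancel, succ_mul_pow_div_factorial_mul_Gamma, Nat.cast_zero, zero_mul,
    zero_div, zero_add, wrightW]

theorem hasDerivAt_wrightW {lam : ℝ} (hlam : -1 < lam) (mu z : ℂ) :
    HasDerivAt (wrightW lam mu) (wrightW lam (lam + mu) z) z := by
  let c : ℕ → ℂ := fun n => n.factorial * Complex.Gamma (n * lam + mu)
  have hterm : ∀ n y, HasDerivAt (fun x => x ^ n / c n) (n * y ^ (n - 1) / c n) y := fun n y =>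
    (hasDerivAt_pow n y).div_const (c n)
  have hbound : ∀ n, ∀ y ∈ Metric.ball (0 : ℂ) (‖z‖ + 1), ‖n * y ^ (n - 1) / c n‖ ≤
      ‖n * ((‖z‖ + 1 : ℝ) : ℂ) ^ (n - 1) / c n‖ := fun n y hy => by
    rw [mem_ball_zero_iff] at hy
    simp only [norm_div, norm_mul, norm_pow, Complex.norm_of_nonneg (by positivity : 0 ≤ ‖z‖ + 1)]
    gcongr
  have hz : z ∈ Metric.ball (0 : ℂ) (‖z‖ + 1) := by simp
  rw [← tsum_deriv_wrightW_term hlam mu z]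
  exact hasDerivAt_tsum_of_isPreconnected
    (summable_norm_deriv_wrightW_term hlam mu ((‖z‖ + 1 : ℝ) : ℂ)) Metric.isOpen_ball
    (convex_ball _ _).isPreconnected (fun n y _ => hterm n y) hbound hz
    (summable_norm_wrightW_term hlam mu z).of_norm hz

theorem wrightW_sub_one {lam : ℝ} (hlam : -1 < lam) (mu z : ℂ) :
    wrightW lam (mu - 1) z = lam * z * wrightW lam (lam + mu) z + (mu - 1) * wrightW lam mu z := by
  have hderiv := (summable_norm_deriv_wrightW_term hlam mu z).of_norm.mul_left (lam * z)
  have hterm := (summable_norm_wrightW_term hlam mu z).of_norm.mul_left (mu - 1)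
  rw [← tsum_deriv_wrightW_term hlam mu z, wrightW, wrightW, ← tsum_mul_left, ← tsum_mul_left,
    ← hderiv.tsum_add hterm]
  refine tsum_congr fun n => ?_
  have hΓ := Complex.one_div_Gamma_eq_self_mul_one_div_Gamma_add_one (n * lam + (mu - 1))
  rw [show (n * lam + (mu - 1) + 1 : ℂ) = n * lam + mu by ring] at hΓ
  have hpow : z * (n * z ^ (n - 1)) = n * z ^ n := by
    cases n with
    | zero => simp
    | succ n => rw [Nat.add_sub_cancel]; ring
  simp only [div_eq_mul_inv, mul_inv, hΓ]
  linear_combination (-lam * (n.factorial : ℂ)⁻¹ * (Complex.Gamma (n * lam + mu))⁻¹) * hpow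

end WrightFunction

section LinearODE

theorem eq_of_hasDerivAt_clm_apply {E : Type*} [NormedAddCommGroup E] [NormedSpace ℂ E]
    {A : ℂ → E →L[ℂ] E} (hA : Continuous A) {f g : ℂ → E}
    (hf : ∀ z, HasDerivAt f (A z (f z)) z) (hg : ∀ z, HasDerivAt g (A z (g z)) z)
    {z₀ : ℂ} (h₀ : f z₀ = g z₀) : f = g := by
  funext z
  let γ : ℝ → ℂ := fun t => z₀ + t * (z - z₀)
  have hγ : ∀ t, HasDerivAt γ (z - z₀) t := fun t => by
    simpa [γ] using ((Complex.ofRealCLM.hasDerivAt (x := t)).mul_const (z - z₀)).const_add z₀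
  have hγcont : Continuous γ := continuous_iff_continuousAt.2 fun t => (hγ t).continuousAt
  have hsol : ∀ {y : ℂ → E}, (∀ z, HasDerivAt y (A z (y z)) z) →
      ∀ t, HasDerivAt (y ∘ γ) (((z - z₀) • A (γ t)) ((y ∘ γ) t)) t :=
    fun hy t => (hy (γ t)).scomp t (hγ t)
  obtain ⟨K, hK⟩ := (isCompact_Icc (a := (0 : ℝ)) (b := 1)).bddAbove_image
    ((hA.comp hγcont).const_smul (z - z₀)).nnnorm.continuousOn
  have heq : Set.EqOn (f ∘ γ) (g ∘ γ) (Set.Icc 0 1) :=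
    ODE_solution_unique_of_mem_Icc_right (v := fun t x => ((z - z₀) • A (γ t)) x)
      (s := fun _ => Set.univ) (K := K)
      (fun t ht => (((z - z₀) • A (γ t)).lipschitz.weaken
        (hK ⟨t, Set.Ico_subset_Icc_self ht, rfl⟩)).lipschitzOnWith)
      (fun t _ => (hsol hf t).continuousAt.continuousWithinAt)
      (fun t _ => (hsol hf t).hasDerivWithinAt) (fun _ _ => Set.mem_univ _)
      (fun t _ => (hsol hg t).continuousAt.continuousWithinAt)
      (fun t _ => (hsol hg t).hasDerivWithinAt) (fun _ _ => Set.mem_univ _) (by simp [γ, h₀])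
  simpa [γ] using heq (Set.right_mem_Icc.2 zero_le_one)

theorem eq_of_hasDerivAt_second_order {p q f f' g g' : ℂ → ℂ} (hp : Continuous p)
    (hq : Continuous q) (hf : ∀ z, HasDerivAt f (f' z) z)
    (hf' : ∀ z, HasDerivAt f' (p z * f' z + q z * f z) z) (hg : ∀ z, HasDerivAt g (g' z) z)
    (hg' : ∀ z, HasDerivAt g' (p z * g' z + q z * g z) z) {z₀ : ℂ} (h₀ : f z₀ = g z₀)
    (h₀' : f' z₀ = g' z₀) : f = g := by
  let A : ℂ → ℂ × ℂ →L[ℂ] ℂ × ℂ := fun z =>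
    .inl ℂ ℂ ℂ ∘L .snd ℂ ℂ ℂ + p z • .inr ℂ ℂ ℂ ∘L .snd ℂ ℂ ℂ + q z • .inr ℂ ℂ ℂ ∘L .fst ℂ ℂ ℂ
  have hA : Continuous A := by fun_prop
  have hsol : ∀ {y y' : ℂ → ℂ}, (∀ z, HasDerivAt y (y' z) z) →
      (∀ z, HasDerivAt y' (p z * y' z + q z * y z) z) →
      ∀ z, HasDerivAt (fun z => (y z, y' z)) (A z (y z, y' z)) z := fun hy hy' z => by
    simpa [A] using (hy z).prodMk (hy' z)
  have hsystem := eq_of_hasDerivAt_clm_apply hA (hsol hf hf') (hsol hg hg') (Prod.ext h₀ h₀')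
  exact funext fun z => congrArg Prod.fst (congrFun hsystem z)

end LinearODE

section AiryFunction

/-- The real cube root of three, in terms of which the constants of the Airy function and the
rescaling of `M_{2/3}` are polynomial. -/
noncomputable def cbrtThree : ℝ := 3 ^ (1 / 3 : ℝ)

theorem cbrtThree_pos : 0 < cbrtThree := by
  rw [cbrtThree]
  positivity

theorem ofReal_cbrtThree_ne_zero : (cbrtThree : ℂ) ≠ 0 :=
  Complex.ofReal_ne_zero.2 cbrtThree_pos.ne'

theorem cbrtThree_pow (n : ℕ) : cbrtThree ^ n = 3 ^ (n / 3 : ℝ) := by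
  rw [cbrtThree, ← Real.rpow_mul_natCast (by norm_num)]
  ring_nf

theorem ofReal_cbrtThree_cube : (cbrtThree : ℂ) ^ 3 = 3 := by
  rw [← Complex.ofReal_pow, cbrtThree_pow]
  norm_num

theorem ofReal_cbrtThree_pow_six : (cbrtThree : ℂ) ^ 6 = 9 := by
  linear_combination (cbrtThree ^ 3 + 3 : ℂ) * ofReal_cbrtThree_cube

theorem three_rpow_neg_one_third : (3 : ℝ) ^ (-(1 / 3) : ℝ) = cbrtThree⁻¹ := by
  rw [Real.rpow_neg (by norm_num), cbrtThree]

theorem three_rpow_neg_two_thirds : (3 : ℝ) ^ (-(2 / 3) : ℝ) = (cbrtThree ^ 2)⁻¹ := by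
  rw [Real.rpow_neg (by norm_num), cbrtThree_pow, Nat.cast_ofNat]

theorem three_rpow_four_thirds : (3 : ℝ) ^ (4 / 3 : ℝ) = cbrtThree ^ 4 := by
  rw [cbrtThree_pow, Nat.cast_ofNat]

theorem three_rpow_three_halves : (3 : ℝ) ^ (3 / 2 : ℝ) = 3 * √3 := by
  rw [Real.sqrt_eq_rpow, ← Real.rpow_one_add' (by norm_num) (by norm_num)]
  norm_num

theorem factorial_three_mul (k : ℕ) : ((3 * k).factorial : ℂ) =
    27 ^ k * k.factorial * (ascPochhammer ℂ k).eval (1 / 3) * (ascPochhammer ℂ k).eval (2 / 3) := by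
  induction k with
  | zero => simp
  | succ k ih =>
    simp only [show 3 * (k + 1) = 3 * k + 1 + 1 + 1 by ring, Nat.factorial_succ, Nat.cast_mul, ih,
      ascPochhammer_succ_eval]
    push_cast
    ring

theorem factorial_three_mul_add_one (k : ℕ) : ((3 * k + 1).factorial : ℂ) =
    27 ^ k * k.factorial * (ascPochhammer ℂ k).eval (2 / 3) * (ascPochhammer ℂ k).eval (4 / 3) := by
  induction k with
  | zero => simp
  | succ k ih =>
    simp only [show 3 * (k + 1) + 1 = 3 * k + 1 + 1 + 1 + 1 by ring, Nat.factorial_succ (3 * k + 1),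
      Nat.factorial_succ (3 * k + 1 + 1), Nat.factorial_succ (3 * k + 1 + 1 + 1),
      Nat.factorial_succ k, Nat.cast_mul, ih, ascPochhammer_succ_eval]
    push_cast
    ring

theorem Gamma_add_natCast_of_re_pos {a : ℂ} (ha : 0 < a.re) (k : ℕ) :
    Complex.Gamma (a + k) = Complex.Gamma a * (ascPochhammer ℂ k).eval a := by
  have hne : ∀ m : ℕ, a ≠ -m := by
    rintro m rfl
    exact m.cast_nonneg.not_gt (by simpa using ha : (m : ℝ) < 0)
  rw [← Complex.Gamma_add_nat_div_Gamma_eq a hne,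
    mul_div_cancel₀ _ (Complex.Gamma_ne_zero_of_re_pos ha)]

theorem eval_ascPochhammer_ne_zero_of_re_pos {a : ℂ} (ha : 0 < a.re) (k : ℕ) :
    (ascPochhammer ℂ k).eval a ≠ 0 := by
  have hΓ : Complex.Gamma (a + k) ≠ 0 :=
    Complex.Gamma_ne_zero_of_re_pos (by simpa using add_pos_of_pos_of_nonneg ha k.cast_nonneg)
  exact right_ne_zero_of_mul (Gamma_add_natCast_of_re_pos ha k ▸ hΓ)

theorem wrightW_one_eq_tsum_ascPochhammer {mu : ℂ} (hmu : 0 < mu.re) (x : ℂ) :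
    Complex.Gamma mu * wrightW 1 mu x =
      ∑' k : ℕ, x ^ k / (k.factorial * (ascPochhammer ℂ k).eval mu) := by
  have hΓ := Complex.Gamma_ne_zero_of_re_pos hmu
  rw [wrightW, ← tsum_mul_left]
  refine tsum_congr fun k => ?_
  rw [Complex.ofReal_one, mul_one, add_comm (k : ℂ), Gamma_add_natCast_of_re_pos hmu]
  field_simp

theorem airyF_eq_wrightW (w : ℂ) :
    airyF w = Complex.Gamma (2 / 3) * wrightW 1 (2 / 3) (w ^ 3 / 9) := by
  rw [wrightW_one_eq_tsum_ascPochhammer (by norm_num)]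
  refine tsum_congr fun k => ?_
  have h₁ := eval_ascPochhammer_ne_zero_of_re_pos (a := 1 / 3) (by norm_num) k
  rw [factorial_three_mul, div_pow, ← pow_mul, show (27 : ℂ) = 3 * 9 by norm_num, mul_pow]
  field_simp

theorem airyG_eq_wrightW (w : ℂ) :
    airyG w = w / 3 * Complex.Gamma (1 / 3) * wrightW 1 (4 / 3) (w ^ 3 / 9) := by
  have hΓ : Complex.Gamma (4 / 3) = 1 / 3 * Complex.Gamma (1 / 3) := by
    rw [← Complex.Gamma_add_one _ (by norm_num)]
    norm_num
  have hseries := wrightW_one_eq_tsum_ascPochhammer (mu := 4 / 3) (by norm_num) (w ^ 3 / 9)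
  rw [show w / 3 * Complex.Gamma (1 / 3) = w * Complex.Gamma (4 / 3) by rw [hΓ]; ring, mul_assoc,
    hseries, ← tsum_mul_left]
  refine tsum_congr fun k => ?_
  have h₂ := eval_ascPochhammer_ne_zero_of_re_pos (a := 2 / 3) (by norm_num) k
  rw [factorial_three_mul_add_one, div_pow, ← pow_mul, pow_succ, show (27 : ℂ) = 3 * 9 by norm_num,
    mul_pow]
  field_simp

theorem airyAi_eq_wrightW (w : ℂ) : airyAi w =
    (cbrtThree ^ 2 : ℂ)⁻¹ * wrightW 1 (2 / 3) (w ^ 3 / 9)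
      - (cbrtThree : ℂ)⁻¹ * (w / 3) * wrightW 1 (4 / 3) (w ^ 3 / 9) := by
  have h₁ : Complex.Gamma (1 / 3) ≠ 0 := Complex.Gamma_ne_zero_of_re_pos (by norm_num)
  have h₂ : Complex.Gamma (2 / 3) ≠ 0 := Complex.Gamma_ne_zero_of_re_pos (by norm_num)
  rw [airyAi, airyF_eq_wrightW, airyG_eq_wrightW, three_rpow_neg_one_third,
    three_rpow_neg_two_thirds]
  push_cast [← Complex.Gamma_ofReal]
  field_simp

theorem hasDerivAt_wrightW_one_cube_div_nine {mu mu' : ℂ} (hmu : mu + 1 = mu') (w : ℂ) :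
    HasDerivAt (fun w => wrightW 1 mu (w ^ 3 / 9)) (w ^ 2 / 3 * wrightW 1 mu' (w ^ 3 / 9)) w := by
  convert! (hasDerivAt_wrightW (lam := 1) (by norm_num) mu (w ^ 3 / 9)).comp w
    ((hasDerivAt_pow 3 w).div_const 9) using 1
  rw [Complex.ofReal_one, ← hmu, add_comm mu]
  push_cast
  ring

theorem hasDerivAt_airyAi (w : ℂ) : HasDerivAt airyAi
    ((cbrtThree ^ 2 : ℂ)⁻¹ * (w ^ 2 / 3) * wrightW 1 (5 / 3) (w ^ 3 / 9)
      - (cbrtThree : ℂ)⁻¹ * wrightW 1 (1 / 3) (w ^ 3 / 9)) w := by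
  have h₂ := hasDerivAt_wrightW_one_cube_div_nine (by norm_num : (2 / 3 + 1 : ℂ) = 5 / 3) w
  have h₄ := hasDerivAt_wrightW_one_cube_div_nine (by norm_num : (4 / 3 + 1 : ℂ) = 7 / 3) w
  have hcontig : wrightW 1 (1 / 3) (w ^ 3 / 9) =
      w ^ 3 / 9 * wrightW 1 (7 / 3) (w ^ 3 / 9) + 1 / 3 * wrightW 1 (4 / 3) (w ^ 3 / 9) := by
    convert wrightW_sub_one (lam := 1) (by norm_num) (4 / 3) (w ^ 3 / 9) using 1 <;> norm_num
  rw [funext airyAi_eq_wrightW]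
  convert! (h₂.const_mul _).sub ((((hasDerivAt_id w).div_const 3).const_mul _).mul h₄) using 1
  rw [hcontig, id]
  ring

theorem deriv_airyAi (w : ℂ) : deriv airyAi w =
    (cbrtThree ^ 2 : ℂ)⁻¹ * (w ^ 2 / 3) * wrightW 1 (5 / 3) (w ^ 3 / 9)
      - (cbrtThree : ℂ)⁻¹ * wrightW 1 (1 / 3) (w ^ 3 / 9) :=
  (hasDerivAt_airyAi w).deriv

theorem hasDerivAt_deriv_airyAi (w : ℂ) : HasDerivAt (deriv airyAi) (w * airyAi w) w := by
  have h₅ := hasDerivAt_wrightW_one_cube_div_nine (by norm_num : (5 / 3 + 1 : ℂ) = 8 / 3) w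
  have h₁ := hasDerivAt_wrightW_one_cube_div_nine (by norm_num : (1 / 3 + 1 : ℂ) = 4 / 3) w
  have hcontig : wrightW 1 (2 / 3) (w ^ 3 / 9) =
      w ^ 3 / 9 * wrightW 1 (8 / 3) (w ^ 3 / 9) + 2 / 3 * wrightW 1 (5 / 3) (w ^ 3 / 9) := by
    convert wrightW_sub_one (lam := 1) (by norm_num) (5 / 3) (w ^ 3 / 9) using 1 <;> norm_num
  rw [funext deriv_airyAi, airyAi_eq_wrightW]
  convert! ((((hasDerivAt_pow 2 w).div_const 3).const_mul _).mul h₅).sub (h₁.const_mul _) using 1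
  rw [hcontig]
  push_cast
  ring

theorem hasDerivAt_comp_sq_add_comp_sq_mul_exp {A A' : ℂ → ℂ} (hA : ∀ w, HasDerivAt A (A' w) w)
    (hA' : ∀ w, HasDerivAt A' (w * A w) w) {p q : ℂ → ℂ} {p' q' t : ℂ} (hp : HasDerivAt p p' t)
    (hq : HasDerivAt q q' t) :
    HasDerivAt (fun t => (p t * A (t ^ 2) + q t * A' (t ^ 2)) * Complex.exp (-2 * t ^ 3 / 3))
      (((p' - 2 * t ^ 2 * p t + 2 * t ^ 3 * q t) * A (t ^ 2)
        + (q' - 2 * t ^ 2 * q t + 2 * t * p t) * A' (t ^ 2)) * Complex.exp (-2 * t ^ 3 / 3)) t := by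
  have hAsq := (hA (t ^ 2)).comp t (hasDerivAt_pow 2 t)
  have hA'sq := (hA' (t ^ 2)).comp t (hasDerivAt_pow 2 t)
  have hexp := (((hasDerivAt_pow 3 t).const_mul (-2)).div_const 3).cexp
  convert! ((hp.mul hAsq).add (hq.mul hA'sq)).mul hexp using 1
  simp only [Function.comp_apply, Pi.mul_apply, Pi.add_apply]
  push_cast
  ring

/-- The combination `(t Ai(t²) - Ai'(t²)) exp(-2t³/3)`, which is `M_{2/3}` up to rescaling of the
argument and of the value by powers of the cube root of three. -/
noncomputable def airyProfile (t : ℂ) : ℂ :=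
  (t * airyAi (t ^ 2) - deriv airyAi (t ^ 2)) * Complex.exp (-2 * t ^ 3 / 3)

theorem hasDerivAt_airyProfile (t : ℂ) : HasDerivAt airyProfile
    (((1 - 4 * t ^ 3) * airyAi (t ^ 2) + 4 * t ^ 2 * deriv airyAi (t ^ 2)) *
      Complex.exp (-2 * t ^ 3 / 3)) t := by
  unfold airyProfile
  convert! hasDerivAt_comp_sq_add_comp_sq_mul_exp
    (fun w => (hasDerivAt_airyAi w).differentiableAt.hasDerivAt) hasDerivAt_deriv_airyAi
    (hasDerivAt_id t) (hasDerivAt_const t (-1)) using 1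
  · funext t
    rw [id]
    ring
  · rw [id]
    ring

theorem deriv_airyProfile (t : ℂ) : deriv airyProfile t =
    ((1 - 4 * t ^ 3) * airyAi (t ^ 2) + 4 * t ^ 2 * deriv airyAi (t ^ 2)) *
      Complex.exp (-2 * t ^ 3 / 3) :=
  (hasDerivAt_airyProfile t).deriv

theorem hasDerivAt_deriv_airyProfile (t : ℂ) : HasDerivAt (deriv airyProfile)
    (-4 * t ^ 2 * deriv airyProfile t - 10 * t * airyProfile t) t := by
  rw [deriv_airyProfile, funext deriv_airyProfile, airyProfile]
  convert! hasDerivAt_comp_sq_add_comp_sq_mul_exp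
    (fun w => (hasDerivAt_airyAi w).differentiableAt.hasDerivAt) hasDerivAt_deriv_airyAi
    (((hasDerivAt_pow 3 t).const_mul 4).const_sub 1) ((hasDerivAt_pow 2 t).const_mul 4) using 1
  push_cast
  ring

theorem airyProfile_zero : airyProfile 0 = -deriv airyAi 0 := by
  simp [airyProfile]

theorem deriv_airyProfile_zero : deriv airyProfile 0 = airyAi 0 := by
  simp [deriv_airyProfile]

end AiryFunction

section WrightMTwoThirds

theorem wrightM_two_thirds_eq_wrightW (z : ℂ) :
    wrightM (2 / 3) z = wrightW (-(2 / 3)) (1 / 3) (-z) := by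
  rw [wrightM]
  norm_num

theorem hasDerivAt_wrightM_two_thirds (z : ℂ) :
    HasDerivAt (wrightM (2 / 3)) (-wrightW (-(2 / 3)) (-(1 / 3)) (-z)) z := by
  have hW : HasDerivAt (wrightW (-(2 / 3)) (1 / 3)) (wrightW (-(2 / 3)) (-(1 / 3)) (-z)) (-z) := by
    convert hasDerivAt_wrightW (lam := -(2 / 3)) _ (1 / 3) (-z) using 2 <;> norm_num
  rw [funext wrightM_two_thirds_eq_wrightW]
  convert! hW.comp z (hasDerivAt_neg z) using 1
  ring_nf

theorem wrightW_neg_two_thirds_neg_one (x : ℂ) : wrightW (-(2 / 3)) (-1) x =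
    4 / 9 * x ^ 2 * wrightW (-(2 / 3)) (-(1 / 3)) x
      + 10 / 9 * x * wrightW (-(2 / 3)) (1 / 3) x := by
  have hcontig (mu : ℂ) := wrightW_sub_one (lam := -(2 / 3)) (by norm_num) mu x
  have hneg_one : wrightW (-(2 / 3)) (-1) x =
      -(2 / 3) * x * wrightW (-(2 / 3)) (-(2 / 3)) x - wrightW (-(2 / 3)) 0 x := by
    convert hcontig 0 using 1 <;> norm_num [sub_eq_add_neg]
  have hzero : wrightW (-(2 / 3)) 0 x = -(2 / 3) * x * wrightW (-(2 / 3)) (1 / 3) x := by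
    convert hcontig 1 using 1 <;> norm_num
  have hneg_two_thirds : wrightW (-(2 / 3)) (-(2 / 3)) x =
      -(2 / 3) * x * wrightW (-(2 / 3)) (-(1 / 3)) x
        - 2 / 3 * wrightW (-(2 / 3)) (1 / 3) x := by
    convert hcontig (1 / 3) using 1 <;> norm_num [sub_eq_add_neg]
  rw [hneg_one, hneg_two_thirds, hzero]
  ring

theorem deriv_wrightM_two_thirds (z : ℂ) :
    deriv (wrightM (2 / 3)) z = -wrightW (-(2 / 3)) (-(1 / 3)) (-z) :=
  (hasDerivAt_wrightM_two_thirds z).deriv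

theorem hasDerivAt_deriv_wrightM_two_thirds (z : ℂ) : HasDerivAt (deriv (wrightM (2 / 3)))
    (-(4 / 9) * z ^ 2 * deriv (wrightM (2 / 3)) z + -(10 / 9) * z * wrightM (2 / 3) z) z := by
  have hW : HasDerivAt (wrightW (-(2 / 3)) (-(1 / 3))) (wrightW (-(2 / 3)) (-1) (-z)) (-z) := by
    convert hasDerivAt_wrightW (lam := -(2 / 3)) _ (-(1 / 3)) (-z) using 2 <;> norm_num
  rw [deriv_wrightM_two_thirds, wrightM_two_thirds_eq_wrightW, funext deriv_wrightM_two_thirds]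
  convert! (hW.comp z (hasDerivAt_neg z)).neg using 1
  rw [wrightW_neg_two_thirds_neg_one]
  ring

theorem wrightM_two_thirds_zero : wrightM (2 / 3) 0 = -cbrtThree * deriv airyAi 0 := by
  rw [wrightM_two_thirds_eq_wrightW, deriv_airyAi]
  simp [wrightW_zero, cbrtThree_pos.ne']

theorem deriv_wrightM_two_thirds_zero :
    cbrtThree * deriv (wrightM (2 / 3)) 0 = airyAi 0 := by
  have hΓ := Complex.one_div_Gamma_eq_self_mul_one_div_Gamma_add_one (-(1 / 3))
  rw [show (-(1 / 3) + 1 : ℂ) = 2 / 3 by norm_num] at hΓ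
  rw [deriv_wrightM_two_thirds, airyAi_eq_wrightW]
  simp only [neg_zero, ne_eq, OfNat.ofNat_ne_zero, not_false_eq_true, zero_pow, zero_div, mul_zero,
    zero_mul, wrightW_zero, sub_zero, hΓ]
  rw [eq_inv_mul_iff_mul_eq₀ (pow_ne_zero _ ofReal_cbrtThree_ne_zero)]
  linear_combination (1 / 3 * (Complex.Gamma (2 / 3))⁻¹) * ofReal_cbrtThree_cube

theorem wrightM_two_thirds_eq_airyProfile (z : ℂ) :
    wrightM (2 / 3) z = cbrtThree * airyProfile (z / cbrtThree ^ 2) := by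
  have hρ := ofReal_cbrtThree_ne_zero
  have hscale (z : ℂ) := (hasDerivAt_id z).div_const (cbrtThree ^ 2 : ℂ)
  have hprofile (z : ℂ) : HasDerivAt (fun z => cbrtThree * airyProfile (z / cbrtThree ^ 2))
      ((cbrtThree : ℂ)⁻¹ * deriv airyProfile (z / cbrtThree ^ 2)) z := by
    convert! ((hasDerivAt_airyProfile _).comp z (hscale z)).const_mul (cbrtThree : ℂ) using 1
    rw [← deriv_airyProfile, id]
    field_simp
  have hprofile' (z : ℂ) : HasDerivAt
      (fun z => (cbrtThree : ℂ)⁻¹ * deriv airyProfile (z / cbrtThree ^ 2))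
      (-(4 / 9) * z ^ 2 * ((cbrtThree : ℂ)⁻¹ * deriv airyProfile (z / cbrtThree ^ 2))
        + -(10 / 9) * z * (cbrtThree * airyProfile (z / cbrtThree ^ 2))) z := by
    convert! ((hasDerivAt_deriv_airyProfile _).comp z (hscale z)).const_mul (cbrtThree : ℂ)⁻¹
      using 1
    rw [id, show (9 : ℂ) = (cbrtThree ^ 3) ^ 2 by rw [ofReal_cbrtThree_cube]; norm_num]
    field_simp
    ring
  refine congrFun (eq_of_hasDerivAt_second_order (z₀ := 0) (by fun_prop) (by fun_prop)
    (fun z => (hasDerivAt_wrightM_two_thirds z).differentiableAt.hasDerivAt)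
    hasDerivAt_deriv_wrightM_two_thirds hprofile hprofile' ?_ ?_) z
  · rw [wrightM_two_thirds_zero, zero_div, airyProfile_zero, mul_neg, neg_mul]
  · rw [zero_div, deriv_airyProfile_zero, ← deriv_wrightM_two_thirds_zero,
      inv_mul_cancel_left₀ hρ]

end WrightMTwoThirds

section BesselFunction

theorem besselI_eq_wrightW (ν z : ℂ) :
    besselI ν z = (z / 2) ^ ν * wrightW 1 (ν + 1) (z ^ 2 / 4) := by
  rw [besselI, wrightW]
  congr! 6 with k
  push_cast
  ring

theorem besselK_of_forall_ne_intCast {ν : ℂ} (hν : ∀ m : ℤ, ν ≠ m) (z : ℂ) :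
    besselK ν z = Real.pi / 2 * (besselI (-ν) z - besselI ν z) / Complex.sin (ν * Real.pi) :=
  if_neg (not_exists.2 hν)

theorem pow_cpow_natCast_div_natCast {s : ℂ} {n : ℕ} (hn : n ≠ 0) (hlo : -(Real.pi / n) < s.arg)
    (hhi : s.arg ≤ Real.pi / n) (k : ℕ) : (s ^ n) ^ (k / n : ℂ) = s ^ k := by
  rw [div_eq_mul_inv, Complex.cpow_nat_mul, Complex.pow_cpow_nat_inv hn hlo hhi]

theorem natCast_div_natCast_ne_intCast {k n : ℕ} (hn : n ≠ 0) (hk : ¬n ∣ k) (m : ℤ) :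
    (k / n : ℂ) ≠ m := fun h => hk (by
  rw [div_eq_iff (Nat.cast_ne_zero.2 hn)] at h
  exact Int.natCast_dvd_natCast.1 (Dvd.intro_left m (by exact_mod_cast h.symm)))

theorem besselK_natCast_div_natCast_two_mul_pow {k n : ℕ} (hn : n ≠ 0) (hk : ¬n ∣ k) {s : ℂ}
    (hlo : -(Real.pi / n) < s.arg) (hhi : s.arg ≤ Real.pi / n) :
    besselK (k / n) (2 * s ^ n) = Real.pi / 2 *
      ((s ^ k)⁻¹ * wrightW 1 (1 - k / n) (s ^ (2 * n))
        - s ^ k * wrightW 1 (1 + k / n) (s ^ (2 * n))) / Complex.sin (k / n * Real.pi) := by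
  have hsq : (2 * s ^ n) ^ 2 / 4 = s ^ (2 * n) := by ring
  rw [besselK_of_forall_ne_intCast (natCast_div_natCast_ne_intCast hn hk), besselI_eq_wrightW,
    besselI_eq_wrightW, mul_div_cancel_left₀ _ two_ne_zero, Complex.cpow_neg,
    pow_cpow_natCast_div_natCast hn hlo hhi, neg_add_eq_sub, add_comm (k / n : ℂ), hsq]

theorem besselK_one_third {s : ℂ} (hlo : -(Real.pi / 3) < s.arg) (hhi : s.arg ≤ Real.pi / 3) :
    besselK (1 / 3) (2 * s ^ 3) = Real.pi / (√3 : ℝ) *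
      (s⁻¹ * wrightW 1 (2 / 3) (s ^ 6) - s * wrightW 1 (4 / 3) (s ^ 6)) := by
  have hsin : Complex.sin (1 / 3 * Real.pi) = (√3 / 2 : ℝ) := by
    rw [← Real.sin_pi_div_three]
    push_cast
    ring_nf
  have hK : besselK (1 / 3) (2 * s ^ 3) = Real.pi / 2 *
      (s⁻¹ * wrightW 1 (2 / 3) (s ^ 6) - s * wrightW 1 (4 / 3) (s ^ 6)) /
        Complex.sin (1 / 3 * Real.pi) := by
    convert besselK_natCast_div_natCast_two_mul_pow (k := 1) (n := 3) (by norm_num) (by norm_num)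
      (by exact_mod_cast hlo) (by exact_mod_cast hhi) using 1 <;> norm_num
  rw [hK, hsin, Complex.ofReal_div, Complex.ofReal_ofNat]
  field_simp

theorem besselK_two_thirds {s : ℂ} (hlo : -(Real.pi / 3) < s.arg) (hhi : s.arg ≤ Real.pi / 3) :
    besselK (2 / 3) (2 * s ^ 3) = Real.pi / (√3 : ℝ) *
      ((s ^ 2)⁻¹ * wrightW 1 (1 / 3) (s ^ 6) - s ^ 2 * wrightW 1 (5 / 3) (s ^ 6)) := by
  have hsin : Complex.sin (2 / 3 * Real.pi) = (√3 / 2 : ℝ) := by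
    rw [← Real.sin_pi_div_three, ← Real.sin_pi_sub]
    push_cast
    ring_nf
  have hK : besselK (2 / 3) (2 * s ^ 3) = Real.pi / 2 *
      ((s ^ 2)⁻¹ * wrightW 1 (1 / 3) (s ^ 6) - s ^ 2 * wrightW 1 (5 / 3) (s ^ 6)) /
        Complex.sin (2 / 3 * Real.pi) := by
    convert besselK_natCast_div_natCast_two_mul_pow (k := 2) (n := 3) (by norm_num) (by norm_num)
      (by exact_mod_cast hlo) (by exact_mod_cast hhi) using 1 <;> norm_num
  rw [hK, hsin, Complex.ofReal_div, Complex.ofReal_ofNat]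
  field_simp

theorem arg_div_ofReal {r : ℝ} (hr : 0 < r) (z : ℂ) : (z / r).arg = z.arg := by
  rw [div_eq_inv_mul, ← Complex.ofReal_inv, Complex.arg_real_mul _ (inv_pos.2 hr)]

theorem ofReal_sqrt_three_sq : ((√3 : ℝ) : ℂ) ^ 2 = 3 := by
  rw [← Complex.ofReal_pow, Real.sq_sqrt (by norm_num), Complex.ofReal_ofNat]

theorem airyAi_sq_eq_besselK {t : ℂ} (ht : t ≠ 0) (hlo : -(Real.pi / 3) < t.arg)
    (hhi : t.arg ≤ Real.pi / 3) :
    airyAi (t ^ 2) = t / (√3 * Real.pi : ℝ) * besselK (1 / 3) (2 * t ^ 3 / 3) := by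
  have hρ := ofReal_cbrtThree_ne_zero
  have hπ : (Real.pi : ℂ) ≠ 0 := Complex.ofReal_ne_zero.2 Real.pi_ne_zero
  have hK := besselK_one_third (s := t / cbrtThree) (by rwa [arg_div_ofReal cbrtThree_pos])
    (by rwa [arg_div_ofReal cbrtThree_pos])
  rw [div_pow, div_pow, ofReal_cbrtThree_cube, ← mul_div_assoc,
    ofReal_cbrtThree_pow_six] at hK
  rw [hK, airyAi_eq_wrightW, ← pow_mul]
  push_cast
  field_simp
  rw [ofReal_sqrt_three_sq]
  linear_combination (-3 * wrightW 1 (2 / 3) (t ^ 6 / 9)) * ofReal_cbrtThree_cube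

theorem deriv_airyAi_sq_eq_besselK {t : ℂ} (ht : t ≠ 0) (hlo : -(Real.pi / 3) < t.arg)
    (hhi : t.arg ≤ Real.pi / 3) :
    deriv airyAi (t ^ 2) = -t ^ 2 / (√3 * Real.pi : ℝ) * besselK (2 / 3) (2 * t ^ 3 / 3) := by
  have hρ := ofReal_cbrtThree_ne_zero
  have hπ : (Real.pi : ℂ) ≠ 0 := Complex.ofReal_ne_zero.2 Real.pi_ne_zero
  have hK := besselK_two_thirds (s := t / cbrtThree) (by rwa [arg_div_ofReal cbrtThree_pos])
    (by rwa [arg_div_ofReal cbrtThree_pos])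
  rw [div_pow _ _ 3, div_pow _ _ 6, ofReal_cbrtThree_cube, ← mul_div_assoc,
    ofReal_cbrtThree_pow_six] at hK
  rw [hK, deriv_airyAi, ← pow_mul]
  push_cast
  field_simp
  rw [ofReal_sqrt_three_sq]
  linear_combination (3 * cbrtThree * wrightW 1 (1 / 3) (t ^ 6 / 9)) * ofReal_cbrtThree_cube

theorem airyProfile_eq_besselK {t : ℂ} (ht : t ≠ 0) (hlo : -(Real.pi / 3) < t.arg)
    (hhi : t.arg ≤ Real.pi / 3) :
    airyProfile t = t ^ 2 / (√3 * Real.pi : ℝ) *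
      (besselK (1 / 3) (2 * t ^ 3 / 3) + besselK (2 / 3) (2 * t ^ 3 / 3)) *
        Complex.exp (-2 * t ^ 3 / 3) := by
  rw [airyProfile, airyAi_sq_eq_besselK ht hlo hhi, deriv_airyAi_sq_eq_besselK ht hlo hhi]
  ring

end BesselFunction

theorem mainTheorem8 :
    (∀ z : ℂ,
      wrightM (2 / 3) z =
        ((((3 : ℝ) ^ (-(1 / 3) : ℝ) : ℝ) : ℂ) * z
            * airyAi (z ^ 2 / (((3 : ℝ) ^ (4 / 3 : ℝ) : ℝ) : ℂ))
          - (((3 : ℝ) ^ (1 / 3 : ℝ) : ℝ) : ℂ)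
            * deriv airyAi (z ^ 2 / (((3 : ℝ) ^ (4 / 3 : ℝ) : ℝ) : ℂ)))
        * Complex.exp (-2 * z ^ 3 / 27)) ∧
    (∀ z : ℂ, z ≠ 0 → -(Real.pi / 3) < z.arg → z.arg ≤ Real.pi / 3 →
      wrightM (2 / 3) z =
        z ^ 2 / ((((3 : ℝ) ^ (3 / 2 : ℝ) : ℝ) : ℂ) * (Real.pi : ℂ))
        * (besselK (1 / 3) (2 * z ^ 3 / 27) + besselK (2 / 3) (2 * z ^ 3 / 27))
        * Complex.exp (-2 * z ^ 3 / 27)) := by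
  have hcube (z : ℂ) : (z / cbrtThree ^ 2) ^ 3 = z ^ 3 / 9 := by
    rw [div_pow, ← pow_mul, ofReal_cbrtThree_pow_six]
  have hexp (z : ℂ) : -2 * (z / cbrtThree ^ 2) ^ 3 / 3 = -2 * z ^ 3 / 27 := by rw [hcube]; ring
  have hρ := ofReal_cbrtThree_ne_zero
  refine ⟨fun z => ?_, fun z hz hlo hhi => ?_⟩
  · have hsq : (z / cbrtThree ^ 2) ^ 2 = z ^ 2 / (cbrtThree ^ 4 : ℝ) := by
      rw [div_pow, ← pow_mul, Complex.ofReal_pow]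
    rw [wrightM_two_thirds_eq_airyProfile, airyProfile, hsq, hexp, three_rpow_neg_one_third,
      three_rpow_four_thirds, ← cbrtThree, Complex.ofReal_inv]
    field_simp
  · have harg := arg_div_ofReal (pow_pos cbrtThree_pos 2) z
    have hK : 2 * (z / cbrtThree ^ 2) ^ 3 / 3 = 2 * z ^ 3 / 27 := by rw [hcube]; ring
    rw [Complex.ofReal_pow] at harg
    rw [wrightM_two_thirds_eq_airyProfile, airyProfile_eq_besselK
      (div_ne_zero hz (pow_ne_zero 2 hρ)) (by rwa [harg]) (by rwa [harg]), hexp, hK,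
      three_rpow_three_halves]
    push_cast
    rw [← ofReal_cbrtThree_cube]
    field_simp
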